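/- **Setting.** Let $T>0$, let $(\Omega,\mathcal F,\mathbf P)$ be a probability space with a filtration $\mathbb F=\{\mathcal F_t\}_{t\in[0,T]}$ satisfying the usual conditions, and let $\mathbf P^*$ be a probability measure equivalent to $\mathbf P$ (for instance, the minimal martingale measure for $S$). Let $X$ and $S$ be real-valued $\mathbb F$-adapted processes on $[0,T]$, and let $\mathcal H_t=\mathcal F^S_t$, $t\in[0,T]$, be the natural filtration of $S$, made complete and right-continuous. Let $\mathcal P(\mathbb R)$ be the space of probability measures on $\mathbb R$ with the weak topology, and let $\pi$ be the filter of $X$: an $(\mathcal H_t)$-adapted, $\mathcal P(\mathbb R)$-valued process such that $\pi_t$ is a version of the conditional law of $X_t$ given $\mathcal H_t$ under $\mathbf P$, for each $t\in[0,T]$. Let $H(t,x,s)$ be a measurable function on $[0,T]\times\mathbb R^2$ such that $\xi=H(T,X_T,S_T)$ is in $L^2(\mathbf P)$ and ${}^o\xi=E^{\mathbf P}[\xi|\mathcal H_T]$ is in $L^2(\mathbf P^*)$, and put $\pi_T(H)=\int_{\mathbb R}H(T,y,S_T)\,\pi_T(dy)$ and $V^{\mathcal H}_t=E^{\mathbf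 P^*}[{}^o\xi|\mathcal H_t]$. Suppose that $(X,S,\pi)$ is an $(\mathbb F,\mathbf P^*)$-Markov process with a jointly measurable transition function $Q_{s,t}(z,dy)$, $0\le s\le t\le T$, on $\mathbb R^2\times\mathcal P(\mathbb R)$, and let $\mathcal L^*$ be its full generator, acting on functions of time and state: $f\in D(\mathcal L^*)$ with $\mathcal L^*f=h$ means that $f$ and $h$ are measurable functions on $[0,T]\times\mathbb R^2\times\mathcal P(\mathbb R)$ such that, for all $0\le s\le t\le T$ and all $z$, $\int |f(t,y)|\,Q_{s,t}(z,dy)<\infty$, $\int_s^t\!\int|h(u,y)|\,Q_{s,u}(z,dy)\,du<\infty$, and $$\int f(t,y)\,Q_{s,t}(z,dy)-f(s,z)=\int_s^t\!\int h(u,y)\,Q_{s,u}(z,dy)\,du .$$ **Lemma 4.1.** Let $\tilde g\in D(\mathcal L^*)$ be such that $$\mathcal L^*\tilde g(t,x,s,p)=0,\qquad (t,x,s,p)\in[0,T)\times\mathbb R^2\times\mathcal P(\mathbb R),$$ $$\tilde g(T,x,s,p)=p(H)=\int_{\mathbb R}H(T,y,s)\,p(dy),\qquad (x,s,p)\in\mathbb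 R^2\times\mathcal P(\mathbb R),$$ the terminal condition being required where the integral converges absolutely. Then $H(T,\cdot,S_T)$ is $\pi_T$-integrable $\mathbf P$-a.s., $\pi_T(H)$ is $\mathbf P^*$-integrable, and for every $t\in[0,T]$ $$\tilde g(t,X_t,S_t,\pi_t)=E^{\mathbf P^*}[\pi_T(H)\,|\,\mathcal F_t]\qquad \mathbf P\text{-a.s.}$$ Consequently, if $g$ is any measurable function on $[0,T]\times\mathbb R^2\times\mathcal P(\mathbb R)$ such that $g(t,X_t,S_t,\pi_t)=E^{\mathbf P^*}[\pi_T(H)|\mathcal F_t]$ a.s. for every $t\in[0,T]$, then $\tilde g(t,X_t,S_t,\pi_t)=g(t,X_t,S_t,\pi_t)$ $\mathbf P$-a.s. for every $t\in[0,T]$; and $V^{\mathcal H}_t=E^{\mathbf P^*}[\tilde g(t,X_t,S_t,\pi_t)|\mathcal H_t]$ a.s. for every $t\in[0,T]$. -/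

import Mathlib

open MeasureTheory ProbabilityTheory
open scoped ENNReal

noncomputable section

/-- The time interval `[0, T]`. -/
abbrev TimeInterval (T : ℝ) : Type := Set.Icc (0 : ℝ) T

/-- The terminal time `T`, as a point of `[0, T]`. -/
def terminalTime {T : ℝ} (hT : 0 < T) : TimeInterval T := ⟨T, hT.le, le_rfl⟩

/-- The initial time `0`, as a point of `[0, T]`. -/
def initialTime {T : ℝ} (hT : 0 < T) : TimeInterval T := ⟨0, le_rfl, hT.le⟩

/-- Lebesgue measure `du` on `[0, T]`. -/
def timeMeasure (T : ℝ) : Measure (TimeInterval T) :=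
  (volume : Measure ℝ).comap Subtype.val

section Filtrations

variable {Ω : Type*} [mΩ : MeasurableSpace Ω] {T : ℝ}

/-- The usual conditions on a filtration indexed by `[0, T]`: it is right-continuous, and `𝓕 0`
contains every subset of a null set (`P N` is the outer measure of `N`). -/
structure UsualConditions (P : Measure Ω) (hT : 0 < T)
    (𝓕 : Filtration (TimeInterval T) mΩ) : Prop where
  rightContinuous : 𝓕.IsRightContinuous
  complete : ∀ N : Set Ω, P N = 0 → MeasurableSet[𝓕 (initialTime hT)] N

/-- The `σ`-algebra generated by the null events. -/
abbrev nullEvents (P : Measure Ω) : MeasurableSpace Ω :=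
  MeasurableSpace.generateFrom {N | MeasurableSet N ∧ P N = 0}

lemma nullEvents_le (P : Measure Ω) : nullEvents P ≤ mΩ :=
  MeasurableSpace.generateFrom_le fun _ hN => hN.1

/-- `t ↦ σ(S_u, u ≤ t) ∨ {null events}`. -/
def completedNatural (P : Measure Ω) (S : TimeInterval T → Ω → ℝ) (hS : ∀ t, Measurable (S t)) :
    Filtration (TimeInterval T) mΩ where
  seq t := Filtration.natural S (fun u => (hS u).stronglyMeasurable) t ⊔ nullEvents P
  mono' _ _ hst := sup_le_sup_right
    ((Filtration.natural S (fun u => (hS u).stronglyMeasurable)).mono hst) _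
  le' t := sup_le ((Filtration.natural S (fun u => (hS u).stronglyMeasurable)).le t)
    (nullEvents_le P)

/-- The natural filtration of `S`, made complete and right-continuous. -/
def observationFiltration (P : Measure Ω) (S : TimeInterval T → Ω → ℝ)
    (hS : ∀ t, Measurable (S t)) : Filtration (TimeInterval T) mΩ :=
  (completedNatural P S hS).rightCont

/-- `π` is the filter of `X` given the filtration `𝓗`: a `𝓗`-adapted process with values in the
probability measures on `ℝ` such that `π t` is a version of the conditional law of `X t` given
`𝓗 t` under `P`. -/
structure IsFilter (P : Measure Ω) (𝓗 : Filtration (TimeInterval T) mΩ)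
    (X : TimeInterval T → Ω → ℝ) (π : TimeInterval T → Ω → ProbabilityMeasure ℝ) : Prop where
  adapted : ∀ t, Measurable[𝓗 t] (π t)
  condLaw : ∀ t, ∀ B : Set ℝ, MeasurableSet B →
    (fun ω => (π t ω : Measure ℝ).real B) =ᵐ[P] P[(X t ⁻¹' B).indicator (fun _ => (1 : ℝ)) | 𝓗 t]

end Filtrations

section MarkovProcesses

variable {E : Type*} [MeasurableSpace E] {T : ℝ}

/-- A (time-inhomogeneous) transition function on `E` over `[0, T]`: `Q s t z B` is the
probability to be in `B` at time `t` when starting from `z` at time `s ≤ t`. The values of `Q s t`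
for `t < s` play no role. -/
structure IsTransitionFunction (Q : TimeInterval T → TimeInterval T → Kernel E E) : Prop where
  markov : ∀ s t, s ≤ t → IsMarkovKernel (Q s t)
  refl : ∀ t, Q t t = Kernel.id
  chapmanKolmogorov : ∀ s t u, s ≤ t → t ≤ u → Q t u ∘ₖ Q s t = Q s u
  measurable : ∀ B : Set E, MeasurableSet B →
    Measurable fun q : {q : TimeInterval T × TimeInterval T // q.1 ≤ q.2} × E =>
      Q q.1.1.1 q.1.1.2 q.2 B

/-- `Z` is an `(𝓕, μ)`-Markov process with transition function `Q`. -/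
structure IsMarkovProcess {Ω : Type*} [mΩ : MeasurableSpace Ω] (μ : Measure Ω)
    (𝓕 : Filtration (TimeInterval T) mΩ) (Z : TimeInterval T → Ω → E)
    (Q : TimeInterval T → TimeInterval T → Kernel E E) : Prop where
  transition : IsTransitionFunction Q
  adapted : ∀ t, Measurable[𝓕 t] (Z t)
  markovProperty : ∀ s t, s ≤ t → ∀ B : Set E, MeasurableSet B →
    μ[(Z t ⁻¹' B).indicator (fun _ => (1 : ℝ)) | 𝓕 s] =ᵐ[μ] fun ω => (Q s t (Z s ω)).real B

/-- The graph of the (full) generator, acting on functions `f (t, z)` of time and state, of the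
Markov evolution with transition function `Q`: the pairs `(f, h)`, `h` being "the generator
applied to `f`", of measurable functions with
`∫ f(t, y) Q_{s,t}(z, dy) - f(s, z) = ∫_s^t ∫ h(u, y) Q_{s,u}(z, dy) du`.
In terms of the semigroup `(𝒯_r f)(s, z) = ∫ f(s + r, y) Q_{s,s+r}(z, dy)` of the space-time
process this is `𝒯_r f - f = ∫_0^r 𝒯_u h du`. The functions need not be bounded, only integrable
for the transition function (which is automatic for bounded ones). -/
def generatorGraph (Q : TimeInterval T → TimeInterval T → Kernel E E) :
    Set ((TimeInterval T → E → ℝ) × (TimeInterval T → E → ℝ)) :=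
  {p | (Measurable fun q : TimeInterval T × E => p.1 q.1 q.2) ∧
    (Measurable fun q : TimeInterval T × E => p.2 q.1 q.2) ∧
    ∀ s t, s ≤ t → ∀ z,
      Integrable (p.1 t) (Q s t z) ∧
      ∫⁻ u in Set.Ioc s t, ∫⁻ y, ‖p.2 u y‖ₑ ∂(Q s u z) ∂(timeMeasure T) < ∞ ∧
      ∫ y, p.1 t y ∂(Q s t z) - p.1 s z =
        ∫ u in Set.Ioc s t, ∫ y, p.2 u y ∂(Q s u z) ∂(timeMeasure T)}

end MarkovProcesses

/-- The state space `ℝ² × 𝒫(ℝ)` of the triplet `(X, S, π)`. -/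
abbrev FilterState : Type := ℝ × ℝ × ProbabilityMeasure ℝ

end

/-! With zero generator before `T`, the defining integral identity says that `gt t z` is the `Q t T
z`-integral of `gt T`. The Markov property turns this into the conditional expectation, given `𝓕 t`,
of `gt T` along `(X, S, π)`, and the terminal condition identifies that variable with `π_T(H)`. One
disintegration principle, `integral_condLaw_ae_eq_condExp`, is used twice: under `P` with the filter
as kernel, giving `π_T(H) = E[ξ | 𝓗_T]`, and under `Pstar` with the transition kernel. Equivalence
of the measures transfers null sets; the value process then follows from the tower property, since
`𝓗 ≤ 𝓕`. -/

section ConditionalLaw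

variable {Ω A E : Type*} {m : MeasurableSpace Ω} [mΩ : MeasurableSpace Ω] [MeasurableSpace A]
  [MeasurableSpace E] {μ : Measure Ω} [IsFiniteMeasure μ] {W : Ω → A} {Y : Ω → E}
  {κ : Kernel A E} [IsMarkovKernel κ]

/-- If `κ (W ω)` is a version of the conditional law of `Y` given `m`, then `κ` disintegrates the
joint law of `(W, Y)` under the restriction of the measure to any event of `m`. -/
lemma map_prodMk_restrict_eq_compProd (hm : m ≤ mΩ) (hW : Measurable[m] W) (hY : Measurable Y)
    (hlaw : ∀ B : Set E, MeasurableSet B →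
      μ[(Y ⁻¹' B).indicator (fun _ => (1 : ℝ)) | m] =ᵐ[μ] fun ω => (κ (W ω)).real B)
    {F : Set Ω} (hF : MeasurableSet[m] F) :
    (μ.restrict F).map (fun ω => (W ω, Y ω)) = (μ.restrict F).map W ⊗ₘ κ := by
  have hW' : Measurable W := hW.mono hm le_rfl
  refine Measure.ext_prod fun {a B} ha hB => ?_
  have hWa : MeasurableSet[m] (W ⁻¹' a) := hW ha
  -- The condition `W ∈ a` is absorbed into the conditioning event, so on rectangles the claim is
  -- the defining property of the conditional expectation.
  have hG : MeasurableSet[m] (W ⁻¹' a ∩ F) := hWa.inter hF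
  have hreal : ∫ ω in W ⁻¹' a ∩ F, (κ (W ω)).real B ∂μ
      = μ.real (Y ⁻¹' B ∩ (W ⁻¹' a ∩ F)) := by
    rw [← setIntegral_congr_ae (hm _ hG) ((hlaw B hB).mono fun ω h _ => h),
      setIntegral_condExp hm ((integrable_const _).indicator (hY hB)) hG,
      integral_indicator_const _ (hY hB), smul_eq_mul, mul_one,
      measureReal_restrict_apply (hY hB)]
  have hmeas : Measurable fun ω => κ (W ω) B := (κ.measurable_coe hB).comp hW'
  rw [Measure.compProd_apply_prod ha hB, setLIntegral_map ha (κ.measurable_coe hB) hW',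
    Measure.restrict_restrict (hm _ hWa), Measure.map_apply (hW'.prodMk hY) (ha.prod hB),
    Measure.restrict_apply (hW'.prodMk hY (ha.prod hB))]
  have hfin : ∫⁻ ω in W ⁻¹' a ∩ F, κ (W ω) B ∂μ ≠ ∞ := by
    refine ((lintegral_mono fun ω => prob_le_one).trans_lt ?_).ne
    simp
  rw [← ENNReal.toReal_eq_toReal_iff' (measure_ne_top _ _) hfin]
  rw [← integral_toReal hmeas.aemeasurable (ae_of_all _ fun ω => measure_lt_top _ _)]
  refine Eq.trans ?_ hreal.symm
  simp only [measureReal_def]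
  congr 2
  ext ω
  simp only [Set.mem_inter_iff, Set.mem_preimage, Set.mem_prod]
  tauto

/-- A function that is integrable for the joint law is integrable for almost every conditional
law. -/
lemma ae_integrable_condLaw (hm : m ≤ mΩ) (hW : Measurable[m] W) (hY : Measurable Y)
    (hlaw : ∀ B : Set E, MeasurableSet B →
      μ[(Y ⁻¹' B).indicator (fun _ => (1 : ℝ)) | m] =ᵐ[μ] fun ω => (κ (W ω)).real B)
    {f : A × E → ℝ} (hf : Measurable f) (hint : Integrable (fun ω => f (W ω, Y ω)) μ) :
    ∀ᵐ ω ∂μ, Integrable (fun y => f (W ω, y)) (κ (W ω)) := by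
  have hW' : Measurable W := hW.mono hm le_rfl
  have hmap := map_prodMk_restrict_eq_compProd hm hW hY hlaw MeasurableSet.univ
  rw [Measure.restrict_univ] at hmap
  have hi : Integrable f (μ.map W ⊗ₘ κ) := by
    rw [← hmap, integrable_map_measure hf.aestronglyMeasurable (hW'.prodMk hY).aemeasurable]
    exact hint
  exact ae_of_ae_map hW'.aemeasurable
    ((Measure.integrable_compProd_iff hf.aestronglyMeasurable).1 hi).1

/-- The conditional expectation of a function of `(W, Y)`, with `W` known, is its integral for the
conditional law of `Y`. -/
lemma integral_condLaw_ae_eq_condExp (hm : m ≤ mΩ) (hW : Measurable[m] W) (hY : Measurable Y)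
    (hlaw : ∀ B : Set E, MeasurableSet B →
      μ[(Y ⁻¹' B).indicator (fun _ => (1 : ℝ)) | m] =ᵐ[μ] fun ω => (κ (W ω)).real B)
    {f : A × E → ℝ} (hf : Measurable f) (hint : Integrable (fun ω => f (W ω, Y ω)) μ) :
    (fun ω => ∫ y, f (W ω, y) ∂(κ (W ω))) =ᵐ[μ] μ[fun ω => f (W ω, Y ω) | m] := by
  have hW' : Measurable W := hW.mono hm le_rfl
  have hsm : StronglyMeasurable fun a => ∫ y, f (a, y) ∂(κ a) :=
    hf.stronglyMeasurable.integral_kernel_prod_right'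
  have hcomp : ∀ F, MeasurableSet[m] F → Integrable f ((μ.restrict F).map W ⊗ₘ κ) := by
    intro F hF
    rw [← map_prodMk_restrict_eq_compProd hm hW hY hlaw hF,
      integrable_map_measure hf.aestronglyMeasurable (hW'.prodMk hY).aemeasurable]
    exact hint.restrict
  -- Disintegrating under `μ.restrict F` makes each set integral a full integral, to which Fubini
  -- applies.
  refine ae_eq_condExp_of_forall_setIntegral_eq hm hint (fun F hF _ => ?_) (fun F hF _ => ?_)
    (hsm.comp_measurable hW).aestronglyMeasurable
  · exact (integrable_map_measure hsm.aestronglyMeasurable hW'.aemeasurable).1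
      (hcomp F hF).integral_compProd
  · rw [← integral_map (φ := W) (f := fun a => ∫ y, f (a, y) ∂(κ a)) hW'.aemeasurable
      hsm.aestronglyMeasurable, ← Measure.integral_compProd (hcomp F hF),
      ← map_prodMk_restrict_eq_compProd hm hW hY hlaw hF,
      integral_map (hW'.prodMk hY).aemeasurable hf.aestronglyMeasurable]

end ConditionalLaw

/-- The tautological kernel from the probability measures on `E` to `E`. -/
def probabilityMeasureKernel (E : Type*) [MeasurableSpace E] :
    Kernel (ProbabilityMeasure E) E where
  toFun p := p
  measurable' := measurable_subtype_coe

instance (E : Type*) [MeasurableSpace E] : IsMarkovKernel (probabilityMeasureKernel E) :=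
  ⟨fun p => p.2⟩

/-- Completeness of `𝓕` at time `0` absorbs the null events, and its right-continuity absorbs the
right limits. -/
lemma observationFiltration_le {Ω : Type*} [mΩ : MeasurableSpace Ω] {T : ℝ} {hT : 0 < T}
    {P : Measure Ω} {𝓕 : Filtration (TimeInterval T) mΩ} (h𝓕 : UsualConditions P hT 𝓕)
    {S : TimeInterval T → Ω → ℝ} (hS : ∀ t, Measurable[𝓕 t] (S t))
    (hS' : ∀ t, Measurable (S t)) :
    observationFiltration P S hS' ≤ 𝓕 := by
  have hle : completedNatural P S hS' ≤ 𝓕 := by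
    intro t
    refine sup_le ?_ (MeasurableSpace.generateFrom_le fun N hN =>
      𝓕.mono (show initialTime hT ≤ t from t.2.1) _ (h𝓕.complete N hN.2))
    exact iSup₂_le fun u hu => (hS u).comap_le.trans (𝓕.mono hu)
  have hrc := h𝓕.rightContinuous.RC
  refine le_trans ?_ hrc
  intro t
  rw [observationFiltration, Filtration.rightCont_apply, Filtration.rightCont_apply]
  split_ifs
  · exact iInf₂_mono fun u _ => hle u
  · exact hle t

lemma measurable_observationFiltration {Ω : Type*} [mΩ : MeasurableSpace Ω] {T : ℝ}
    {P : Measure Ω} {S : TimeInterval T → Ω → ℝ} (hS : ∀ t, Measurable (S t))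
    (t : TimeInterval T) : Measurable[observationFiltration P S hS t] (S t) := by
  have h : Measurable[Filtration.natural S (fun u => (hS u).stronglyMeasurable) t] (S t) :=
    (Filtration.stronglyAdapted_natural fun u => (hS u).stronglyMeasurable) t |>.measurable
  exact h.mono (le_sup_left.trans ((completedNatural P S hS).le_rightCont t)) le_rfl

/-- A function in the domain of the generator that is mapped to `0` before the terminal time is
propagated by the transition function. -/
lemma integral_terminal_eq_of_generator_eq_zero {E : Type*} [MeasurableSpace E] {T : ℝ}
    (hT : 0 < T) {Q : TimeInterval T → TimeInterval T → Kernel E E}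
    {f h : TimeInterval T → E → ℝ} (hdom : (f, h) ∈ generatorGraph Q)
    (hzero : ∀ t, t < terminalTime hT → ∀ z, h t z = 0) (t : TimeInterval T) (z : E) :
    ∫ y, f (terminalTime hT) y ∂(Q t (terminalTime hT) z) = f t z := by
  have heq := (hdom.2.2 t (terminalTime hT) t.2.2 z).2.2
  -- Nothing is known about `h` at the terminal time, which belongs to the interval of integration
  -- but is Lebesgue-null.
  have hnull : timeMeasure T {terminalTime hT} = 0 := by
    rw [timeMeasure, (MeasurableEmbedding.subtype_coe measurableSet_Icc).comap_apply]
    simp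
  have hae : ∀ᵐ u ∂timeMeasure T, u < terminalTime hT := by
    filter_upwards [measure_eq_zero_iff_ae_notMem.1 hnull] with u hu
    exact lt_of_le_of_ne u.2.2 hu
  have hint : ∫ u in Set.Ioc t (terminalTime hT), ∫ y, h u y ∂(Q t u z) ∂(timeMeasure T) = 0 := by
    refine integral_eq_zero_of_ae ?_
    filter_upwards [ae_restrict_of_ae hae] with u hu
    simp [hzero u hu]
  exact sub_eq_zero.1 (heq.trans hint)

theorem lemma4p1 {Ω : Type*} [mΩ : MeasurableSpace Ω] {T : ℝ} (hT : 0 < T)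
    -- the real-world measure and an equivalent measure (e.g. the minimal martingale measure)
    (P Pstar : Measure Ω) [IsProbabilityMeasure P] [IsProbabilityMeasure Pstar]
    (hPstar_ac : Pstar ≪ P) (hP_ac : P ≪ Pstar)
    (𝓕 : Filtration (TimeInterval T) mΩ) (h𝓕 : UsualConditions P hT 𝓕)
    -- the unobserved factor, the observed process, and the filter
    (X S : TimeInterval T → Ω → ℝ)
    (hX : ∀ t, Measurable[𝓕 t] (X t)) (hS : ∀ t, Measurable[𝓕 t] (S t))
    (𝓗 : Filtration (TimeInterval T) mΩ)
    (h𝓗 : 𝓗 = observationFiltration P S (fun t => (hS t).mono (𝓕.le t) le_rfl))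
    (π : TimeInterval T → Ω → ProbabilityMeasure ℝ) (hπ : IsFilter P 𝓗 X π)
    -- the claim `ξ = H(T, X_T, S_T)`
    (H : TimeInterval T → ℝ → ℝ → ℝ)
    (hH : Measurable fun q : TimeInterval T × ℝ × ℝ => H q.1 q.2.1 q.2.2)
    (ξ : Ω → ℝ)
    (hξ : ξ = fun ω => H (terminalTime hT) (X (terminalTime hT) ω) (S (terminalTime hT) ω))
    (hξ_L2 : MemLp ξ 2 P)
    (hproj_L2 : MemLp (P[ξ | 𝓗 (terminalTime hT)]) 2 Pstar)
    -- `(X, S, π)` is an `(𝓕, Pstar)`-Markov process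
    (Q : TimeInterval T → TimeInterval T → Kernel FilterState FilterState)
    (hMarkov : IsMarkovProcess Pstar 𝓕 (fun t ω => (X t ω, S t ω, π t ω)) Q)
    -- `gt` is in the domain of the generator, which maps it to `Lgt`
    (gt Lgt : TimeInterval T → FilterState → ℝ)
    (hdom : (gt, Lgt) ∈ generatorGraph Q)
    (hzero : ∀ t, t < terminalTime hT → ∀ z, Lgt t z = 0)
    -- terminal condition, wherever `p(H)` makes sense
    (hterminal : ∀ (x s : ℝ) (p : ProbabilityMeasure ℝ),
      Integrable (fun y => H (terminalTime hT) y s) (p : Measure ℝ) →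
      gt (terminalTime hT) (x, s, p) = ∫ y, H (terminalTime hT) y s ∂(p : Measure ℝ))
    -- the random variable `π_T(H)`
    (πTH : Ω → ℝ)
    (hπTH : πTH = fun ω =>
      ∫ y, H (terminalTime hT) y (S (terminalTime hT) ω) ∂(π (terminalTime hT) ω : Measure ℝ)) :
    -- `π_T(H)` is well defined and integrable
    (∀ᵐ ω ∂P, Integrable (fun y => H (terminalTime hT) y (S (terminalTime hT) ω))
      (π (terminalTime hT) ω : Measure ℝ)) ∧
    Integrable πTH Pstar ∧
    -- the conditional expectation of `π_T(H)` is given by `gt`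
    (∀ t, (fun ω => gt t (X t ω, S t ω, π t ω)) =ᵐ[P] Pstar[πTH | 𝓕 t]) ∧
    -- `gt` agrees along `(X, S, π)` with any `g` that represents this conditional expectation
    (∀ g : TimeInterval T → FilterState → ℝ,
      (Measurable fun q : TimeInterval T × FilterState => g q.1 q.2) →
      (∀ t, (fun ω => g t (X t ω, S t ω, π t ω)) =ᵐ[Pstar] Pstar[πTH | 𝓕 t]) →
      ∀ t, (fun ω => gt t (X t ω, S t ω, π t ω)) =ᵐ[P] fun ω => g t (X t ω, S t ω, π t ω)) ∧
    -- and it represents the value process `V_t = E*[E[ξ | 𝓗_T] | 𝓗_t]`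
    (∀ t, Pstar[P[ξ | 𝓗 (terminalTime hT)] | 𝓗 t] =ᵐ[Pstar]
      Pstar[fun ω => gt t (X t ω, S t ω, π t ω) | 𝓗 t]) := by
  set τ := terminalTime hT with hτ
  have hSm : ∀ t, Measurable (S t) := fun t => (hS t).mono (𝓕.le t) le_rfl
  have hXm : ∀ t, Measurable (X t) := fun t => (hX t).mono (𝓕.le t) le_rfl
  have hle : 𝓗 ≤ 𝓕 := h𝓗 ▸ observationFiltration_le h𝓕 hS hSm
  have hSobs : Measurable[𝓗 τ] (S τ) := by
    subst h𝓗
    exact measurable_observationFiltration hSm τ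
  -- the conditional law of `X τ` given `𝓗 τ`, as a kernel in `(S τ, π τ)`
  let κ : Kernel (ℝ × ProbabilityMeasure ℝ) ℝ :=
    (probabilityMeasureKernel ℝ).comap Prod.snd measurable_snd
  -- `S τ` is kept although `κ` ignores it: the integrand `H` depends on it.
  have hW : Measurable[𝓗 τ] fun ω => (S τ ω, π τ ω) := hSobs.prodMk (hπ.adapted τ)
  have hlaw : ∀ B : Set ℝ, MeasurableSet B →
      P[(X τ ⁻¹' B).indicator (fun _ => (1 : ℝ)) | 𝓗 τ] =ᵐ[P]
        fun ω => (κ (S τ ω, π τ ω)).real B := fun B hB => (hπ.condLaw τ B hB).symm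
  have hHm : Measurable fun q : (ℝ × ProbabilityMeasure ℝ) × ℝ => H τ q.2 q.1.1 :=
    hH.comp (measurable_const.prodMk (measurable_snd.prodMk measurable_fst.fst))
  have hξint : Integrable (fun ω => H τ (X τ ω) (S τ ω)) P := hξ ▸ hξ_L2.integrable one_le_two
  have hHint : ∀ᵐ ω ∂P, Integrable (fun y => H τ y (S τ ω)) (π τ ω : Measure ℝ) :=
    ae_integrable_condLaw (κ := κ) (𝓗.le τ) hW (hXm τ) hlaw hHm hξint
  have hproj : πTH =ᵐ[P] P[ξ | 𝓗 τ] := by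
    rw [hπTH, hξ]
    exact integral_condLaw_ae_eq_condExp (κ := κ) (𝓗.le τ) hW (hXm τ) hlaw hHm hξint
  have hproj' : πTH =ᵐ[Pstar] P[ξ | 𝓗 τ] := hPstar_ac.ae_eq hproj
  -- Integrability under `P` does not pass to an equivalent measure; it comes from the assumption on
  -- the projection of `ξ`.
  have hπint : Integrable πTH Pstar :=
    (integrable_congr hproj').2 (hproj_L2.integrable one_le_two)
  -- The terminal condition is only available where `p(H)` converges, which holds almost surely
  -- along the filter.
  have hgτ : (fun ω => gt τ (X τ ω, S τ ω, π τ ω)) =ᵐ[Pstar] πTH := by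
    filter_upwards [hPstar_ac.ae_le hHint] with ω hω
    rw [hterminal _ _ _ hω, hπTH]
  have hmain : ∀ t, (fun ω => gt t (X t ω, S t ω, π t ω)) =ᵐ[Pstar] Pstar[πTH | 𝓕 t] := by
    intro t
    have := hMarkov.transition.markov t τ t.2.2
    have hgm : Measurable fun q : FilterState × FilterState => gt τ q.2 :=
      hdom.1.comp (measurable_const.prodMk measurable_snd)
    have hcond := integral_condLaw_ae_eq_condExp (κ := Q t τ) (𝓕.le t) (hMarkov.adapted t)
      ((hMarkov.adapted τ).mono (𝓕.le τ) le_rfl) (hMarkov.markovProperty t τ t.2.2) hgm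
      ((integrable_congr hgτ).2 hπint)
    simp only [integral_terminal_eq_of_generator_eq_zero hT hdom hzero t, hτ] at hcond
    exact hcond.trans (condExp_congr_ae hgτ)
  refine ⟨hHint, hπint, fun t => hP_ac.ae_eq (hmain t),
    fun g _ hg t => hP_ac.ae_eq ((hmain t).trans (hg t).symm), fun t => ?_⟩
  calc Pstar[P[ξ | 𝓗 τ] | 𝓗 t] =ᵐ[Pstar] Pstar[πTH | 𝓗 t] := condExp_congr_ae hproj'.symm
    _ =ᵐ[Pstar] Pstar[Pstar[πTH | 𝓕 t] | 𝓗 t] :=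
      (condExp_condExp_of_le (hle t) (𝓕.le t)).symm
    _ =ᵐ[Pstar] Pstar[fun ω => gt t (X t ω, S t ω, π t ω) | 𝓗 t] :=
      condExp_congr_ae (hmain t).symm
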